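/- A packing of $n$ unit disks in the Euclidean plane (closed disks of radius $1$ with pairwise disjoint interiors) is called totally separable if any two of its disks can be separated by a line that is disjoint from the interior of every disk of the packing. Its contact number is the number of unordered pairs of disks of the packing that touch each other. For every integer $n>1$, the maximum contact number $c(n,2)$ over all totally separable packings of $n$ unit disks in the plane is $$c(n,2)=\lfloor 2n-2\sqrt{n}\rfloor .$$ -/

import Mathlib

namespace SeparablePacking

/-- Euclidean `d`-space. -/
abbrev E (d : ℕ) : Type := EuclideanSpace ℝ (Fin d)

/-- The closed unit ball (unit disk for `d = 2`) with center `x`. -/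
def unitBall {d : ℕ} (x : E d) : Set (E d) := Metric.closedBall x 1

/-- The hyperplane with normal vector `u` (meant to be nonzero) and offset `t`. -/
def hyperplane {d : ℕ} (u : E d) (t : ℝ) : Set (E d) := {x | inner ℝ u x = t}

/-- The sets `A` and `B` lie in opposite closed half-spaces of the hyperplane `(u, t)`.
Interchanging the two sides amounts to replacing `(u, t)` by `(-u, -t)`. -/
def SeparatedBy {d : ℕ} (u : E d) (t : ℝ) (A B : Set (E d)) : Prop :=
  (∀ x ∈ A, inner ℝ u x ≤ t) ∧ (∀ x ∈ B, t ≤ inner ℝ u x)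

/-- The unit balls with centers `c i` form a packing: their interiors are pairwise disjoint. -/
def IsPacking {d n : ℕ} (c : Fin n → E d) : Prop :=
  ∀ i j, i ≠ j → Disjoint (interior (unitBall (c i))) (interior (unitBall (c j)))

/-- A packing of unit balls is totally separable if any two of its balls can be separated by a
hyperplane that is disjoint from the interior of every ball of the packing. -/
def IsTotallySeparable {d n : ℕ} (c : Fin n → E d) : Prop :=
  IsPacking c ∧
    ∀ i j, i ≠ j → ∃ (u : E d) (t : ℝ), u ≠ 0 ∧
      SeparatedBy u t (unitBall (c i)) (unitBall (c j)) ∧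
      ∀ k, Disjoint (hyperplane u t) (interior (unitBall (c k)))

/-- The contact graph: two different balls are adjacent if they touch, i.e. (the balls being
non-overlapping) if they have a common point. -/
def contactGraph {d n : ℕ} (c : Fin n → E d) : SimpleGraph (Fin n) where
  Adj i j := i ≠ j ∧ (unitBall (c i) ∩ unitBall (c j)).Nonempty
  symm := ⟨fun _ _ h => ⟨h.1.symm, by rw [Set.inter_comm]; exact h.2⟩⟩
  loopless := ⟨fun _ h => h.1 rfl⟩

/-- The number of (unordered) touching pairs. -/
noncomputable def contactNumber {d n : ℕ} (c : Fin n → E d) : ℕ :=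
  (contactGraph c).edgeSet.ncard

/-- All contact numbers of totally separable packings of `n` unit balls in `d`-space. -/
def contactNumbers (n d : ℕ) : Set ℕ :=
  {m | ∃ c : Fin n → E d, IsTotallySeparable c ∧ contactNumber c = m}

/-- `c(n, d)`: the maximum contact number of totally separable packings of `n` unit balls
in `d`-space. -/
noncomputable def maxContactNumber (n d : ℕ) : ℕ := sSup (contactNumbers n d)

end SeparablePacking

/-! Upper bound: the line separating two touching disks is their common tangent, and no third disk
may cross it, so two contacts of one disk form an angle of at least π/2
(`IsTotallySeparable.inner_nonpos`). Hence a disk has at most one neighbour in each of four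
half-open quadrants. A quadrant and its opposite organise the disks into chains; with p chains for
one pair of opposite quadrants and q for the other, there are (n - p) + (n - q) contacts. Two chains
of different kinds share at most one disk, so n ≤ pq and p + q ≥ 2√n.

Lower bound: fill a nearly square a × b grid with a + b = ⌈2√n⌉ row by row. -/

namespace SeparablePacking

open Finset

/-! ### Chain decompositions and edge counting -/

section Chains

variable {V : Type*} [Fintype V]

/-- In a finite type, an injective partial function contained in a strict order decomposes the type
into chains; the chains are indexed by their maximal elements. -/
lemma exists_chain_end {r s : V → V → Prop} (hrs : ∀ i j, r i j → s i j) [IsStrictOrder V s]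
    (hinj : ∀ i j k, r i k → r j k → i = j) :
    ∃ f : V → V, (∀ i, ¬ ∃ j, r (f i) j) ∧ ∀ i j, f i = f j → i = j ∨ s i j ∨ s j i := by
  have hwf : WellFounded (Function.swap s) := Finite.wellFounded_of_trans_of_irrefl _
  have key : ∀ i, ∃ z, (¬ ∃ j, r z j) ∧ Relation.ReflTransGen (Function.swap r) z i := by
    intro i
    induction i using hwf.induction with
    | _ i ih =>
      by_cases h : ∃ j, r i j
      · obtain ⟨j, hj⟩ := h
        obtain ⟨z, hz, hzj⟩ := ih j (hrs _ _ hj)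
        exact ⟨z, hz, hzj.tail hj⟩
      · exact ⟨i, h, .refl⟩
  have mono : ∀ i j, Relation.ReflTransGen (Function.swap r) i j → i = j ∨ s j i := by
    intro i j h
    induction h with
    | refl => exact .inl rfl
    | tail _ h ih =>
      rcases ih with rfl | ih
      · exact .inr (hrs _ _ h)
      · exact .inr (_root_.trans (hrs _ _ h) ih)
  choose f hf hfi using key
  refine ⟨f, hf, fun i j hij => ?_⟩
  have hi := hfi i
  rw [hij] at hi
  -- Predecessors are unique by `hinj`, so of two paths descending from the same end one continues
  -- the other.
  rcases Relation.ReflTransGen.total_of_right_unique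
    (fun a b c hb hc => hinj b c a hb hc) hi (hfi j) with h | h
  · rcases mono _ _ h with h | h
    · exact .inl h
    · exact .inr (.inr h)
  · rcases mono _ _ h with h | h
    · exact .inl h.symm
    · exact .inr (.inl h)

open scoped Classical in
/-- A graph whose edges are covered by two injective partial functions, contained in two strict
orders without common comparable pairs, has at most `2n - (p + q)` edges for some `p`, `q` with
`n ≤ p * q`. -/
lemma ncard_edgeSet_add_le {G : SimpleGraph V} {r s r' s' : V → V → Prop}
    [IsStrictOrder V s] [IsStrictOrder V s']
    (hrs : ∀ i j, r i j → s i j) (hrs' : ∀ i j, r' i j → s' i j)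
    (hinj : ∀ i j k, r i k → r j k → i = j) (hinj' : ∀ i j k, r' i k → r' j k → i = j)
    (hfun : ∀ i j k, r i j → r i k → j = k) (hfun' : ∀ i j k, r' i j → r' i k → j = k)
    (hss : ∀ i j, s i j → ¬ s' i j ∧ ¬ s' j i)
    (hG : ∀ i j, G.Adj i j → r i j ∨ r j i ∨ r' i j ∨ r' j i) :
    ∃ p q : ℕ, Fintype.card V ≤ p * q ∧ G.edgeSet.ncard + (p + q) ≤ 2 * Fintype.card V := by
  obtain ⟨f, hf, hf'⟩ := exists_chain_end hrs hinj
  obtain ⟨g, hg, hg'⟩ := exists_chain_end hrs' hinj'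
  set A : Finset V := univ.filter fun i => ∃ j, r i j with hA
  set B : Finset V := univ.filter fun i => ∃ j, r' i j with hB
  have hcA : #A + #(univ.filter fun i => ¬ ∃ j, r i j) = Fintype.card V :=
    card_filter_add_card_filter_not _
  have hcB : #B + #(univ.filter fun i => ¬ ∃ j, r' i j) = Fintype.card V :=
    card_filter_add_card_filter_not _
  refine ⟨#(univ.filter fun i => ¬ ∃ j, r i j), #(univ.filter fun i => ¬ ∃ j, r' i j), ?_, ?_⟩
  · rw [← card_product, ← card_univ]
    -- Distinct vertices with both chain ends equal would be comparable in `s` and in `s'`, against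
    -- `hss`.
    refine card_le_card_of_injOn (fun i => (f i, g i)) (fun i _ => ?_) fun i _ j _ hij => ?_
    · simpa using ⟨by simpa using hf i, by simpa using hg i⟩
    · simp only [Prod.mk.injEq] at hij
      rcases hf' i j hij.1 with h | h | h
      · exact h
      · rcases hg' i j hij.2 with h' | h' | h'
        · exact h'
        · exact absurd h' (hss _ _ h).1
        · exact absurd h' (hss _ _ h).2
      · rcases hg' i j hij.2 with h' | h' | h'
        · exact h'
        · exact absurd h' (hss _ _ h).2
        · exact absurd h' (hss _ _ h).1
  · let φ : V → Sym2 V := fun i => if h : ∃ j, r i j then s(i, h.choose) else s(i, i)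
    let ψ : V → Sym2 V := fun i => if h : ∃ j, r' i j then s(i, h.choose) else s(i, i)
    have hφ : ∀ i j, r i j → φ i = s(i, j) := fun i j h => by
      have h' : ∃ j, r i j := ⟨j, h⟩
      simp only [φ, dif_pos h', hfun i _ _ h'.choose_spec h]
    have hψ : ∀ i j, r' i j → ψ i = s(i, j) := fun i j h => by
      have h' : ∃ j, r' i j := ⟨j, h⟩
      simp only [ψ, dif_pos h', hfun' i _ _ h'.choose_spec h]
    have hsub : G.edgeSet ⊆ ((A.image φ ∪ B.image ψ : Finset (Sym2 V)) : Set (Sym2 V)) := by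
      intro e
      induction e using Sym2.ind with
      | _ i j =>
        intro h
        rw [coe_union, Set.mem_union, mem_coe, mem_coe, mem_image, mem_image]
        simp only [hA, hB, mem_filter, mem_univ, true_and]
        rcases hG i j h with h | h | h | h
        · exact .inl ⟨i, ⟨j, h⟩, hφ _ _ h⟩
        · exact .inl ⟨j, ⟨i, h⟩, (hφ _ _ h).trans Sym2.eq_swap⟩
        · exact .inr ⟨i, ⟨j, h⟩, hψ _ _ h⟩
        · exact .inr ⟨j, ⟨i, h⟩, (hψ _ _ h).trans Sym2.eq_swap⟩
    have hle : G.edgeSet.ncard ≤ #A + #B := by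
      refine (Set.ncard_le_ncard hsub (finite_toSet _)).trans ?_
      rw [Set.ncard_coe_finset]
      exact (card_union_le _ _).trans (add_le_add card_image_le card_image_le)
    lia

end Chains

/-! ### Angles between contacts -/

section Geometry

variable {d n : ℕ}

lemma inner_add_norm_le_of_forall_mem_unitBall {u x : E d} {t : ℝ} (hu : u ≠ 0)
    (h : ∀ y ∈ unitBall x, inner ℝ u y ≤ t) : inner ℝ u x + ‖u‖ ≤ t := by
  have hu' : 0 < ‖u‖ := norm_pos_iff.2 hu
  have := h (x + ‖u‖⁻¹ • u) (by
    simp [unitBall, norm_smul, hu'.ne'])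
  rw [inner_add_right, inner_smul_right, real_inner_self_eq_norm_sq] at this
  convert this using 2
  field_simp

lemma norm_le_abs_of_disjoint {u x : E d} {t : ℝ} (hu : u ≠ 0)
    (h : Disjoint (hyperplane u t) (interior (unitBall x))) : ‖u‖ ≤ |t - inner ℝ u x| := by
  have hu' : 0 < ‖u‖ := norm_pos_iff.2 hu
  by_contra! hlt
  refine Set.disjoint_left.1 h (show x + ((t - inner ℝ u x) / ‖u‖ ^ 2) • u ∈ _ from ?_) ?_
  · simp only [hyperplane, Set.mem_ofPred_eq]
    rw [inner_add_right, inner_smul_right, real_inner_self_eq_norm_sq]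
    field_simp
    ring
  · rw [unitBall, interior_closedBall _ one_ne_zero, mem_ball_iff_norm, add_sub_cancel_left,
      norm_smul, Real.norm_eq_abs, abs_div, abs_of_pos (pow_pos hu' 2), div_mul_eq_mul_div,
      div_lt_one (pow_pos hu' 2), sq]
    exact mul_lt_mul_of_pos_right hlt hu'

/-- In a totally separable packing, two contacts of the same ball form an angle of at least
`π / 2`. -/
lemma IsTotallySeparable.inner_nonpos {c : Fin n → E d} (hc : IsTotallySeparable c) {i j k : Fin n}
    (hij : (contactGraph c).Adj i j) (hik : (contactGraph c).Adj i k) (hjk : j ≠ k) :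
    inner ℝ (c j - c i) (c k - c i) ≤ 0 := by
  have hle : ∀ l, (contactGraph c).Adj i l → ‖c l - c i‖ ≤ 2 := by
    rintro l ⟨-, x, hx, hx'⟩
    rw [unitBall, mem_closedBall_iff_norm] at hx hx'
    calc ‖c l - c i‖ = ‖(x - c i) - (x - c l)‖ := by congr 1; abel
      _ ≤ 2 := (norm_sub_le _ _).trans (by linarith)
  obtain ⟨u, t, hu, ⟨h1, h2⟩, h3⟩ := hc.2 i j hij.1
  obtain ⟨w, s, hw, ⟨h4, h5⟩, -⟩ := hc.2 j k hjk
  have hu' : 0 < ‖u‖ := norm_pos_iff.2 hu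
  have hw' : 0 < ‖w‖ := norm_pos_iff.2 hw
  have hi := inner_add_norm_le_of_forall_mem_unitBall hu h1
  have hj := inner_add_norm_le_of_forall_mem_unitBall (u := -u) (t := -t) (neg_ne_zero.2 hu)
    (fun y hy => by rw [inner_neg_left]; exact neg_le_neg (h2 y hy))
  have hj' := inner_add_norm_le_of_forall_mem_unitBall hw h4
  have hk' := inner_add_norm_le_of_forall_mem_unitBall (u := -w) (t := -s) (neg_ne_zero.2 hw)
    (fun y hy => by rw [inner_neg_left]; exact neg_le_neg (h5 y hy))
  rw [inner_neg_left, norm_neg] at hj hk'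
  have hk := norm_le_abs_of_disjoint hu (h3 k)
  have hne : c j ≠ c k := fun h => by rw [h] at hj'; linarith
  set v := c j - c i with hv
  set e := c k - c i with he
  have hvn : ‖v‖ ≤ 2 := hle j hij
  have hen : ‖e‖ ≤ 2 := hle k hik
  have huv : 2 * ‖u‖ ≤ inner ℝ u v := by rw [hv, inner_sub_right]; linarith
  have hcs := real_inner_le_norm u v
  -- Separation gives ‖v‖ ≥ 2 and contact gives ‖v‖ ≤ 2; equality in Cauchy–Schwarz then makes `u`
  -- parallel to `v`.
  have hvn2 : ‖v‖ = 2 := le_antisymm hvn (by nlinarith)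
  have huv2 : inner ℝ u v = ‖u‖ * ‖v‖ := le_antisymm hcs (by rw [hvn2]; linarith)
  have hpar : ‖v‖ • u = ‖u‖ • v := (inner_eq_norm_mul_iff_real).1 huv2
  rw [hvn2] at hpar
  have hue : 2 * inner ℝ u e = ‖u‖ * inner ℝ v e := by
    rw [← real_inner_smul_left, ← real_inner_smul_left, hpar]
  have ht : t = inner ℝ u (c i) + ‖u‖ := by
    have : inner ℝ u v = inner ℝ u (c j) - inner ℝ u (c i) := inner_sub_right _ _ _
    rw [hvn2] at huv2
    linarith
  have hue' : inner ℝ u e = inner ℝ u (c k) - inner ℝ u (c i) := inner_sub_right _ _ _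
  have hve : ‖v - e‖ ^ 2 = ‖v‖ ^ 2 - 2 * inner ℝ v e + ‖e‖ ^ 2 := norm_sub_sq_real v e
  have hpos : 0 < ‖v - e‖ ^ 2 := by
    refine pow_pos (norm_pos_iff.2 (sub_ne_zero.2 fun h => hne ?_)) 2
    simpa [hv, he] using h
  have hlt : inner ℝ v e < 4 := by
    rw [hvn2] at hve
    nlinarith [norm_nonneg e]
  -- Disk `k` lies on one side of the tangent: beyond it, ⟨v, e⟩ ≥ 4 contradicts `hlt`; on the side
  -- of `i`, ⟨v, e⟩ ≤ 0.
  rcases le_abs.1 hk with h | h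
  · by_contra! hcon
    nlinarith [mul_pos hu' hcon]
  · nlinarith

end Geometry

/-! ### The upper bound -/

section UpperBound

variable {n : ℕ}

/-- Any totally separable packing of `n` unit disks has at most `2n - 2√n` contacts. -/
lemma contactNumber_le {c : Fin n → E 2} (hc : IsTotallySeparable c) :
    (contactNumber c : ℝ) ≤ 2 * n - 2 * √n := by
  -- Each quadrant contains just one of its bounding rays, so these two and their opposites
  -- partition the nonzero vectors, and two vectors in the same one have positive inner product.
  let s : Fin n → Fin n → Prop := fun i j => c i 0 < c j 0 ∧ c i 1 ≤ c j 1
  let s' : Fin n → Fin n → Prop := fun i j => c j 0 ≤ c i 0 ∧ c i 1 < c j 1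
  have : IsStrictOrder (Fin n) s :=
    { irrefl := fun i h => lt_irrefl _ h.1
      trans := fun i j k h h' => ⟨h.1.trans h'.1, h.2.trans h'.2⟩ }
  have : IsStrictOrder (Fin n) s' :=
    { irrefl := fun i h => lt_irrefl _ h.2
      trans := fun i j k h h' => ⟨h'.1.trans h.1, h.2.trans h'.2⟩ }
  have key : ∀ i j k, (contactGraph c).Adj i j → (contactGraph c).Adj i k → j ≠ k →
      (c j 0 - c i 0) * (c k 0 - c i 0) + (c j 1 - c i 1) * (c k 1 - c i 1) ≤ 0 := by
    intro i j k hij hik hjk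
    have := hc.inner_nonpos hij hik hjk
    simp only [PiLp.inner_apply, Fin.sum_univ_two, PiLp.sub_apply, RCLike.inner_apply,
      conj_trivial] at this
    linarith
  obtain ⟨p, q, hpq, hle⟩ := ncard_edgeSet_add_le (G := contactGraph c) (s := s) (s' := s')
    (r := fun i j => (contactGraph c).Adj i j ∧ s i j)
    (r' := fun i j => (contactGraph c).Adj i j ∧ s' i j)
    (fun _ _ h => h.2) (fun _ _ h => h.2)
    (fun i j k h h' => by
      by_contra hne
      nlinarith [key k i j h.1.symm h'.1.symm hne, mul_pos (sub_pos.2 h.2.1) (sub_pos.2 h'.2.1),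
        mul_nonneg (sub_nonneg.2 h.2.2) (sub_nonneg.2 h'.2.2)])
    (fun i j k h h' => by
      by_contra hne
      nlinarith [key k i j h.1.symm h'.1.symm hne, mul_pos (sub_pos.2 h.2.2) (sub_pos.2 h'.2.2),
        mul_nonneg (sub_nonneg.2 h.2.1) (sub_nonneg.2 h'.2.1)])
    (fun i j k h h' => by
      by_contra hne
      nlinarith [key i j k h.1 h'.1 hne, mul_pos (sub_pos.2 h.2.1) (sub_pos.2 h'.2.1),
        mul_nonneg (sub_nonneg.2 h.2.2) (sub_nonneg.2 h'.2.2)])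
    (fun i j k h h' => by
      by_contra hne
      nlinarith [key i j k h.1 h'.1 hne, mul_pos (sub_pos.2 h.2.2) (sub_pos.2 h'.2.2),
        mul_nonneg (sub_nonneg.2 h.2.1) (sub_nonneg.2 h'.2.1)])
    (fun i j h => ⟨fun h' => absurd h.1 h'.1.not_gt, fun h' => absurd h.2 h'.2.not_ge⟩)
    (fun i j h => by
      have hne : ¬ (c i 0 = c j 0 ∧ c i 1 = c j 1) := by
        rintro ⟨h0, h1⟩
        have hcij : c i = c j := by
          ext l
          fin_cases l
          · exact h0
          · exact h1
        refine Set.disjoint_left.1 (hc.1 i j h.1) (show c i ∈ _ from ?_) ?_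
        · simp [unitBall, interior_closedBall]
        · simp [unitBall, interior_closedBall, hcij]
      have h' := h.symm
      simp only [h, h', true_and, s, s']
      rcases lt_trichotomy (c i 0) (c j 0) with h0 | h0 | h0 <;>
        rcases lt_trichotomy (c i 1) (c j 1) with h1 | h1 | h1 <;>
        simp_all [le_of_lt])
  rw [Fintype.card_fin] at hpq hle
  have hpq' : (n : ℝ) ≤ p * q := by exact_mod_cast hpq
  have hle' : (contactNumber c : ℝ) + (p + q) ≤ 2 * n := by exact_mod_cast hle
  have hsqrt : 2 * √(n : ℝ) ≤ p + q := by
    have h0 : (0 : ℝ) ≤ p + q := by positivity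
    have : √(n : ℝ) ≤ (p + q) / 2 := Real.sqrt_le_iff.2
      ⟨by positivity, by nlinarith [sq_nonneg ((p : ℝ) - q)]⟩
    linarith
  linarith

end UpperBound

/-! ### Grid packings -/

section LowerBound

variable {d n : ℕ}

lemma abs_sub_le_norm_sub (x y : E d) (k : Fin d) : |x k - y k| ≤ ‖x - y‖ := by
  simpa using PiLp.norm_apply_le (x - y) k

lemma inner_single (x : E d) (k : Fin d) (a : ℝ) :
    inner ℝ (EuclideanSpace.single k a) x = a * x k := by
  simp [EuclideanSpace.inner_single_left]

/-- Unit balls centered at different points of the lattice `2ℤᵈ` form a totally separable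
packing. -/
lemma isTotallySeparable_of_lattice {c : Fin n → E d} {z : Fin n → Fin d → ℤ}
    (hz : Function.Injective z) (hc : ∀ i k, c i k = 2 * z i k) : IsTotallySeparable c := by
  refine ⟨fun i j hij => ?_, fun i j hij => ?_⟩
  · obtain ⟨k, hk⟩ := Function.ne_iff.1 (hz.ne hij)
    rw [unitBall, unitBall, interior_closedBall _ one_ne_zero, interior_closedBall _ one_ne_zero]
    refine Metric.ball_disjoint_ball ?_
    rw [dist_eq_norm]
    refine le_trans ?_ (abs_sub_le_norm_sub _ _ k)
    have : (1 : ℝ) ≤ |(z i k : ℝ) - z j k| := by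
      exact_mod_cast Int.one_le_abs (sub_ne_zero.2 hk)
    rw [hc, hc, ← mul_sub, abs_mul, abs_two]
    linarith
  · obtain ⟨k, hk⟩ := Function.ne_iff.1 (hz.ne hij)
    obtain ⟨a, ha, hlt⟩ : ∃ a : ℤ, (a = 1 ∨ a = -1) ∧ a * z i k < a * z j k := by
      rcases lt_or_gt_of_ne hk with h | h
      · exact ⟨1, .inl rfl, by linarith⟩
      · exact ⟨-1, .inr rfl, by linarith⟩
    have haR : |(a : ℝ)| = 1 := by rcases ha with rfl | rfl <;> simp
    have hcoord : ∀ x y : E d, |a * x k - a * y k| ≤ ‖x - y‖ := fun x y => by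
      rw [← mul_sub, abs_mul, haR, one_mul]
      exact abs_sub_le_norm_sub x y k
    have hlt' : (a : ℝ) * z i k + 1 ≤ a * z j k := by exact_mod_cast hlt
    -- The offset is odd while every center has an even `k`-th coordinate, so the hyperplane runs
    -- midway between two lattice layers.
    refine ⟨EuclideanSpace.single k (a : ℝ), 2 * (a * z i k) + 1, ?_, ⟨fun x hx => ?_, fun x hx => ?_⟩,
      fun l => Set.disjoint_left.2 fun x hx hx' => ?_⟩
    · rcases ha with rfl | rfl <;> simp
    · rw [unitBall, mem_closedBall_iff_norm] at hx
      have := (abs_le.1 ((hcoord x (c i)).trans hx)).2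
      rw [hc] at this
      rw [inner_single]
      linarith
    · rw [unitBall, mem_closedBall_iff_norm] at hx
      have := (abs_le.1 ((hcoord x (c j)).trans hx)).1
      rw [hc] at this
      rw [inner_single]
      linarith
    · rw [unitBall, interior_closedBall _ one_ne_zero, mem_ball_iff_norm] at hx'
      simp only [hyperplane, Set.mem_ofPred_eq, inner_single] at hx
      have h := abs_lt.1 ((hcoord x (c l)).trans_lt hx')
      rw [hc, hx] at h
      have h1 : (a * z l k : ℤ) < a * z i k + 1 := by
        have : (a : ℝ) * z l k < a * z i k + 1 := by linarith
        exact_mod_cast this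
      have h2 : (a * z i k : ℤ) < a * z l k := by
        have : (a : ℝ) * z i k < a * z l k := by linarith
        exact_mod_cast this
      lia

lemma contactGraph_adj_of_norm {c : Fin n → E d} {i j : Fin n} (hij : i ≠ j)
    (h : ‖c i - c j‖ ≤ 2) : (contactGraph c).Adj i j := by
  refine ⟨hij, midpoint ℝ (c i) (c j), ?_, ?_⟩
  · rw [unitBall, Metric.mem_closedBall, dist_midpoint_left, dist_eq_norm]
    norm_num
    linarith
  · rw [unitBall, Metric.mem_closedBall, dist_midpoint_right, dist_eq_norm]
    norm_num
    linarith

/-- The centers of `n` unit disks filling the rows of an orthogonal grid of width `a`. -/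
noncomputable def grid (n a : ℕ) (i : Fin n) : E 2 :=
  !₂[2 * ((i : ℕ) % a : ℕ), 2 * ((i : ℕ) / a : ℕ)]

lemma isTotallySeparable_grid (n a : ℕ) : IsTotallySeparable (grid n a) := by
  refine isTotallySeparable_of_lattice
    (z := fun i => ![(((i : ℕ) % a : ℕ) : ℤ), (((i : ℕ) / a : ℕ) : ℤ)]) (fun i j h => ?_)
    fun i k => ?_
  · have h0 : (i : ℕ) % a = j % a := Int.ofNat_inj.1 (congrFun h 0)
    have h1 : (i : ℕ) / a = j / a := Int.ofNat_inj.1 (congrFun h 1)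
    ext
    rw [← Nat.div_add_mod (i : ℕ) a, h0, h1, Nat.div_add_mod]
  · fin_cases k <;> simp [grid, -Int.natCast_emod, -Int.natCast_mod, -Int.natCast_ediv]

lemma grid_adj_add_width {a : ℕ} (ha : 0 < a) {i j : Fin n} (h : (j : ℕ) = i + a) :
    (contactGraph (grid n a)).Adj i j := by
  refine contactGraph_adj_of_norm (by rintro rfl; lia) (le_of_eq ?_)
  have h0 : (j : ℕ) % a = i % a := by rw [h, Nat.add_mod_right]
  have h1 : (j : ℕ) / a = i / a + 1 := by rw [h, Nat.add_div_right _ ha]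
  rw [EuclideanSpace.norm_eq, Fin.sum_univ_two, Real.sqrt_eq_iff_mul_self_eq_of_pos two_pos]
  simp only [grid, h0, h1, PiLp.sub_apply]
  simp
  ring

lemma grid_adj_succ {a : ℕ} {i j : Fin n} (h : (j : ℕ) = i + 1) (hd : ¬ a ∣ i + 1) :
    (contactGraph (grid n a)).Adj i j := by
  refine contactGraph_adj_of_norm (by rintro rfl; lia) (le_of_eq ?_)
  have h1 : (j : ℕ) / a = i / a := by rw [h, Nat.succ_div_of_not_dvd hd]
  have h0 : (j : ℕ) % a = i % a + 1 := by
    have hi := Nat.div_add_mod (i : ℕ) a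
    have hj := Nat.div_add_mod (j : ℕ) a
    rw [h1] at hj
    lia
  rw [EuclideanSpace.norm_eq, Fin.sum_univ_two, Real.sqrt_eq_iff_mul_self_eq_of_pos two_pos]
  simp only [grid, h0, h1, PiLp.sub_apply]
  simp
  ring

/-- If `n` disks fit into an `a × b` grid, then the grid packing has at least `2n - (a + b)`
contacts. -/
lemma le_contactNumber_grid {a b : ℕ} (hn : 0 < n) (ha : 0 < a) (hab : n ≤ a * b) :
    2 * n ≤ contactNumber (grid n a) + (a + b) := by
  set S : Finset (ℕ × ℕ) := ((range (n - 1)).filter fun i => ¬ a ∣ i + 1).image fun i => (i, i + 1)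
    with hS
  set T : Finset (ℕ × ℕ) := (range (n - a)).image fun i => (i, i + a) with hT
  have hmemS : ∀ x ∈ S, x.2 < n ∧ x.2 = x.1 + 1 ∧ ¬ a ∣ x.1 + 1 := by
    intro x hx
    obtain ⟨i, hi, rfl⟩ := mem_image.1 hx
    rw [mem_filter, mem_range] at hi
    exact ⟨by dsimp only; lia, rfl, hi.2⟩
  have hmemT : ∀ x ∈ T, x.2 < n ∧ x.2 = x.1 + a := by
    intro x hx
    obtain ⟨i, hi, rfl⟩ := mem_image.1 hx
    rw [mem_range] at hi
    exact ⟨by dsimp only; lia, rfl⟩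
  have hcT : #T = n - a := by
    rw [hT, card_image_of_injective _ fun i j h => (Prod.mk.inj h).1, card_range]
  -- Of the n - 1 consecutive pairs, only the at most b - 1 row breaks are lost.
  have hcS : n - 1 ≤ #S + (b - 1) := by
    rw [hS, card_image_of_injective _ fun i j h => (Prod.mk.inj h).1]
    have h1 := Nat.card_multiples (n - 1) a
    have h2 := card_filter_add_card_filter_not (s := range (n - 1)) (fun i => a ∣ i + 1)
    rw [card_range] at h2
    have h3 : (n - 1) / a < b := (Nat.div_lt_iff_lt_mul ha).2 (by rw [mul_comm]; lia)
    lia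
  have hdisj : Disjoint S T := by
    refine disjoint_left.2 fun x hx hx' => ?_
    obtain ⟨-, h1, h2⟩ := hmemS x hx
    obtain ⟨-, h3⟩ := hmemT x hx'
    have : a = 1 := by lia
    exact h2 (by rw [this]; exact one_dvd _)
  have hlt : ∀ x ∈ S ∪ T, x.1 < x.2 ∧ x.2 < n := by
    intro x hx
    rcases mem_union.1 hx with h | h
    · have := hmemS x h; lia
    · have := hmemT x h; lia
  have hb : 0 < b := Nat.pos_of_ne_zero (by rintro rfl; lia)
  have hcard : #(S ∪ T) ≤ contactNumber (grid n a) := by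
    have : NeZero n := ⟨hn.ne'⟩
    rw [contactNumber, ← Set.ncard_coe_finset]
    -- Pairs are stored with increasing entries, so forgetting the order is injective.
    refine Set.ncard_le_ncard_of_injOn
      (fun x : ℕ × ℕ => s(Fin.ofNat n x.1, Fin.ofNat n x.2)) (fun x hx => ?_) (fun x hx y hy h => ?_)
      (Set.toFinite _)
    · have hx' := hlt x hx
      have e1 : ((Fin.ofNat n x.1 : Fin n) : ℕ) = x.1 := Nat.mod_eq_of_lt (hx'.1.trans hx'.2)
      have e2 : ((Fin.ofNat n x.2 : Fin n) : ℕ) = x.2 := Nat.mod_eq_of_lt hx'.2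
      rw [SimpleGraph.mem_edgeSet]
      rcases mem_union.1 hx with h | h
      · exact grid_adj_succ (by rw [e1, e2]; exact (hmemS x h).2.1)
          (by rw [e1]; exact (hmemS x h).2.2)
      · exact grid_adj_add_width ha (by rw [e1, e2]; exact (hmemT x h).2)
    · have hx' := hlt x hx
      have hy' := hlt y hy
      have e1 : x.1 % n = x.1 := Nat.mod_eq_of_lt (hx'.1.trans hx'.2)
      have e2 : x.2 % n = x.2 := Nat.mod_eq_of_lt hx'.2
      have e3 : y.1 % n = y.1 := Nat.mod_eq_of_lt (hy'.1.trans hy'.2)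
      have e4 : y.2 % n = y.2 := Nat.mod_eq_of_lt hy'.2
      simp only [Sym2.eq_iff, Fin.ext_iff, Fin.ofNat, e1, e2, e3, e4] at h
      ext <;> lia
  rw [card_union_of_disjoint hdisj] at hcard
  lia

end LowerBound

/-- The maximum contact number is attained by a grid packing. -/
lemma isGreatest_contactNumbers {n : ℕ} (hn : 0 < n) :
    ∃ m : ℕ, IsGreatest (contactNumbers n 2) m ∧ (m : ℤ) = ⌊2 * (n : ℝ) - 2 * √(n : ℝ)⌋ := by
  set k := ⌈2 * √(n : ℝ)⌉₊ with hk
  have hn' : (1 : ℝ) ≤ n := by exact_mod_cast hn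
  have hsq : √(n : ℝ) * √n = n := Real.mul_self_sqrt (by positivity)
  have hs1 : 1 ≤ √(n : ℝ) := Real.one_le_sqrt.2 hn'
  have hk1 : 2 * √(n : ℝ) ≤ k := Nat.le_ceil _
  have hk2 : 2 ≤ k := by
    have : (2 : ℝ) ≤ k := by linarith
    exact_mod_cast this
  have hk4 : 4 * n ≤ k * k := by
    have : (4 : ℝ) * n ≤ k * k := by nlinarith
    exact_mod_cast this
  -- The balanced split maximises the area. For odd k it falls short of k² / 4 by 1/4, which
  -- integrality absorbs.
  have hab : n ≤ k / 2 * (k - k / 2) := by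
    obtain ⟨l, hl⟩ := Nat.even_or_odd' k
    rcases hl with hl | hl
    · rw [hl] at hk4 ⊢
      rw [show 2 * l / 2 = l by lia, show 2 * l - l = l by lia]
      nlinarith
    · rw [hl] at hk4 ⊢
      rw [show (2 * l + 1) / 2 = l by lia, show 2 * l + 1 - l = l + 1 by lia]
      have : 4 * n ≤ 4 * (l * (l + 1)) + 1 := by linarith
      lia
  have hge := le_contactNumber_grid hn (show 0 < k / 2 by lia) hab
  have hge' : (2 * n : ℤ) - k ≤ contactNumber (grid n (k / 2)) := by lia
  have hfl : ⌊2 * (n : ℝ) - 2 * √(n : ℝ)⌋ = (2 * n : ℤ) - k := by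
    rw [hk, Int.natCast_ceil_eq_ceil (by positivity)]
    have := Int.floor_intCast_add (2 * n : ℤ) (-(2 * √(n : ℝ)))
    rw [Int.floor_neg] at this
    push_cast at this
    exact this
  have hup : ∀ c : Fin n → E 2, IsTotallySeparable c → (contactNumber c : ℤ) ≤ (2 * n : ℤ) - k :=
    fun c hc => hfl ▸ Int.le_floor.2 (by exact_mod_cast contactNumber_le hc)
  have heq := le_antisymm (hup _ (isTotallySeparable_grid n (k / 2))) hge'
  refine ⟨_, ⟨⟨_, isTotallySeparable_grid n (k / 2), rfl⟩, ?_⟩, heq.trans hfl.symm⟩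
  rintro m ⟨c, hc, rfl⟩
  have := hup c hc
  lia

end SeparablePacking

/-- For all `n > 1` the maximum contact number of totally separable packings of `n` unit disks
in the plane is attained and equals `⌊2n - 2√n⌋`. -/
theorem mainTheorem4 (n : ℕ) (hn : 1 < n) :
    IsGreatest (SeparablePacking.contactNumbers n 2) (SeparablePacking.maxContactNumber n 2) ∧
      (SeparablePacking.maxContactNumber n 2 : ℤ) = ⌊2 * (n : ℝ) - 2 * √(n : ℝ)⌋ := by
  obtain ⟨m, hm, hfl⟩ := SeparablePacking.isGreatest_contactNumbers (zero_lt_one.trans hn)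
  rw [SeparablePacking.maxContactNumber, hm.csSup_eq]
  exact ⟨hm, hfl⟩
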